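/- Let the basic-gate library on two qubits consist of the two CNOT gates (either qubit being the control and the other one the target) and of all one-qubit gates $u\in U(2)$ acting on either qubit, i.e. $u\otimes I$ and $I\otimes u$. A circuit is a finite sequence of such gates, with no further (ancilla) qubits, and it simulates $U\in SU(4)$ if the product of its gates equals $U$ up to a global phase, that is, up to a scalar of modulus one. Then for almost every two-qubit operator $U\in SU(4)$, with respect to the Haar measure of $SU(4)$, every basic-gate circuit that simulates $U$ contains at least three CNOT gates and at least nine basic gates in total (CNOT gates and one-qubit gates together). -/

import Mathlib

open MeasureTheory
open scoped Kronecker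

/-- The group `SU(4)` of normalized two-qubit operators. Its matrices are indexed by the
computational basis states `|x₀ x₁⟩`, written as pairs `(x₀, x₁) : Fin 2 × Fin 2`. -/
abbrev TwoQubitOperator : Type :=
  Matrix.specialUnitaryGroup (Fin 2 × Fin 2) ℂ

namespace TwoQubitOperator

instance : IsTopologicalGroup TwoQubitOperator where
  continuous_mul := by
    refine Continuous.subtype_mk ?_ _
    exact (continuous_subtype_val.comp continuous_fst).mul
      (continuous_subtype_val.comp continuous_snd)
  continuous_inv := by
    refine Continuous.subtype_mk ?_ _
    exact continuous_subtype_val.star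

instance : CompactSpace TwoQubitOperator := by
  refine isCompact_iff_compactSpace.mp ?_
  have hK : IsCompact (Set.pi Set.univ (fun _ : Fin 2 × Fin 2 =>
      Set.pi Set.univ (fun _ : Fin 2 × Fin 2 => Metric.closedBall (0 : ℂ) 1))) :=
    isCompact_univ_pi fun _ => isCompact_univ_pi fun _ => isCompact_closedBall _ _
  have hclosed : IsClosed
      (Matrix.specialUnitaryGroup (Fin 2 × Fin 2) ℂ :
        Set (Matrix (Fin 2 × Fin 2) (Fin 2 × Fin 2) ℂ)) := by
    have h : (Matrix.specialUnitaryGroup (Fin 2 × Fin 2) ℂ :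
        Set (Matrix (Fin 2 × Fin 2) (Fin 2 × Fin 2) ℂ)) =
        {A | A * star A = 1} ∩ {A | A.det = 1} := by
      ext A
      simp [Matrix.mem_specialUnitaryGroup_iff, Matrix.mem_unitaryGroup_iff]
    rw [h]
    exact (isClosed_eq (continuous_id.mul continuous_id.star) continuous_const).inter
      (isClosed_eq continuous_id.matrix_det continuous_const)
  refine IsCompact.of_isClosed_subset hK hclosed ?_
  intro A hA i _ j _
  have := entry_norm_bound_of_unitary
    (Matrix.specialUnitaryGroup_le_unitaryGroup hA) i j
  simpa using this

noncomputable instance : MeasurableSpace TwoQubitOperator := borel _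

instance : BorelSpace TwoQubitOperator := ⟨rfl⟩

/-- The Haar measure of the compact group `SU(4)`, normalized to total mass `1`. -/
noncomputable def haar : Measure TwoQubitOperator :=
  Measure.haarMeasure ⊤

end TwoQubitOperator

/-- The basic-gate library on two qubits: every one-qubit gate, on either wire, and the controlled-not
with either wire as its control (the other wire is the target). -/
inductive BasicGate : Type
  | oneQubit (wire : Fin 2) (u : Matrix.unitaryGroup (Fin 2) ℂ) : BasicGate
  | cnot (control : Fin 2) : BasicGate

namespace BasicGate

/-- The `4 × 4` matrix of a gate. The controlled-not adds, modulo `2`, the bit on its control wire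
to the bit on the other wire; row indices are outputs and column indices are inputs. -/
noncomputable def toMatrix : BasicGate → Matrix (Fin 2 × Fin 2) (Fin 2 × Fin 2) ℂ
  | oneQubit 0 u => (u : Matrix (Fin 2) (Fin 2) ℂ) ⊗ₖ (1 : Matrix (Fin 2) (Fin 2) ℂ)
  | oneQubit 1 u => (1 : Matrix (Fin 2) (Fin 2) ℂ) ⊗ₖ (u : Matrix (Fin 2) (Fin 2) ℂ)
  | cnot 0 => Matrix.of fun y x => if y = (x.1, x.1 + x.2) then 1 else 0
  | cnot 1 => Matrix.of fun y x => if y = (x.1 + x.2, x.2) then 1 else 0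

/-- Whether a gate is a controlled-not. -/
def isCNOT : BasicGate → Bool
  | oneQubit _ _ => false
  | cnot _ => true

end BasicGate

/-- A fully specified two-qubit basic-gate circuit: the list of its gates, the gate applied first
at the head. -/
abbrev BasicCircuit : Type := List BasicGate

namespace BasicCircuit

/-- The operator computed by a circuit. -/
noncomputable def eval : BasicCircuit → Matrix (Fin 2 × Fin 2) (Fin 2 × Fin 2) ℂ
  | [] => 1
  | g :: c => eval c * g.toMatrix

/-- The number of controlled-not gates in a circuit. -/
def cnotCount (c : BasicCircuit) : ℕ := c.countP BasicGate.isCNOT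

/-- The number of basic gates in a circuit, controlled-nots included. -/
def gateCount (c : BasicCircuit) : ℕ := c.length

/-- The circuit simulates the operator `U` up to a global phase. -/
def Simulates (c : BasicCircuit) (U : TwoQubitOperator) : Prop :=
  ∃ z : ℂ, ‖z‖ = 1 ∧ (U : Matrix (Fin 2 × Fin 2) (Fin 2 × Fin 2) ℂ) = z • eval c

end BasicCircuit

/-! The proof is a dimension count: `SU(4)` has real dimension 15, and circuits with at most two
CNOTs, or at most eight gates, reach only a set of dimension at most 14.

Up to phase, a circuit alternates CNOTs with pairs of parallel slots, each empty or holding an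
element of `SU(2)`, which has 3 parameters. A CNOT commutes with Z-rotations on its control and
X-rotations on its target, so a filled slot can pass such a rotation across the CNOT to a filled
neighbour and keep only 2 parameters. Hence `k` CNOTs allow at most `6 + 4k` parameters, which is 14
for `k = 2`; with three or more CNOTs and at most eight gates, too few slots are filled
(`wordDim_le`, `isSmoothlyParametrized_wordGates`). The global phase costs no parameter, since
determinants force it to be an eighth root of unity.

Shapes and phases are countable in number, so it suffices that a smooth image of `ℝᵐ` with `m ≤ 14`
is Haar-null (`TwoQubitOperator.haar_eq_zero`). This follows from Hausdorff dimension in an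
exponential chart, together with Fubini and invariance. -/

open scoped Matrix.Norms.Operator Pointwise

/-- Complex `2 × 2` matrices. -/
abbrev QubitMatrix : Type := Matrix (Fin 2) (Fin 2) ℂ

/-- Complex `4 × 4` matrices, indexed by pairs of bits. -/
abbrev TwoQubitMatrix : Type := Matrix (Fin 2 × Fin 2) (Fin 2 × Fin 2) ℂ

/-! ### Sets covered by finitely many real parameters -/

/-- The set `S` is covered by the image of one continuously differentiable map on `ℝⁿ`. -/
def IsSmoothlyParametrized {M : Type*} [NormedAddCommGroup M] [NormedSpace ℝ M] (n : ℕ)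
    (S : Set M) : Prop :=
  ∃ F : (Fin n → ℝ) → M, ContDiff ℝ 1 F ∧ S ⊆ Set.range F

namespace IsSmoothlyParametrized

variable {M N : Type*} [NormedAddCommGroup M] [NormedSpace ℝ M]
  [NormedAddCommGroup N] [NormedSpace ℝ N]

lemma mono {n : ℕ} {S T : Set M} (hT : IsSmoothlyParametrized n T) (h : S ⊆ T) :
    IsSmoothlyParametrized n S := by
  obtain ⟨F, hF, hr⟩ := hT
  exact ⟨F, hF, h.trans hr⟩

lemma singleton (x : M) : IsSmoothlyParametrized 0 {x} :=
  ⟨fun _ => x, contDiff_const, by simp⟩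

lemma image {n : ℕ} {S : Set M} (hS : IsSmoothlyParametrized n S) {f : M → N}
    (hf : ContDiff ℝ 1 f) : IsSmoothlyParametrized n (f '' S) := by
  obtain ⟨F, hF, hr⟩ := hS
  refine ⟨f ∘ F, hf.comp hF, ?_⟩
  rintro _ ⟨x, hx, rfl⟩
  obtain ⟨t, rfl⟩ := hr hx
  exact ⟨t, rfl⟩

lemma mul {A : Type*} [NormedRing A] [NormedAlgebra ℝ A] {m n : ℕ} {S T : Set A}
    (hS : IsSmoothlyParametrized m S) (hT : IsSmoothlyParametrized n T) :
    IsSmoothlyParametrized (m + n) (S * T) := by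
  obtain ⟨F, hF, hFr⟩ := hS
  obtain ⟨G, hG, hGr⟩ := hT
  refine ⟨fun t => F (fun i => t (Fin.castAdd n i)) * G (fun i => t (Fin.natAdd m i)),
    (hF.comp (by fun_prop)).mul (hG.comp (by fun_prop)), ?_⟩
  rintro _ ⟨x, hx, y, hy, rfl⟩
  obtain ⟨s, rfl⟩ := hFr hx
  obtain ⟨t, rfl⟩ := hGr hy
  exact ⟨Fin.append s t, by simp⟩

end IsSmoothlyParametrized

/-! ### Single-qubit gates modulo rotations about one axis -/

/-- The set of matrices of determinant-one single-qubit gates. -/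
def specialQubitGates : Set QubitMatrix :=
  (Matrix.specialUnitaryGroup (Fin 2) ℂ : Set QubitMatrix)

lemma specialQubitGates_mul_self : specialQubitGates * specialQubitGates = specialQubitGates :=
  coe_mul_coe _

lemma one_mem_specialQubitGates : 1 ∈ specialQubitGates :=
  one_mem (Matrix.specialUnitaryGroup (Fin 2) ℂ)

/-- The Pauli matrix `X` if `b`, and the Pauli matrix `Z` otherwise. -/
def pauli (b : Bool) : QubitMatrix := if b then !![0, 1; 1, 0] else !![1, 0; 0, -1]

/-- The rotations about the axis of a Pauli matrix. -/
noncomputable def axisRotation (b : Bool) (a : ℝ) : QubitMatrix :=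
  Real.cos a • (1 : QubitMatrix) + Real.sin a • (Complex.I • pauli b)

lemma axisRotation_mem (b : Bool) (a : ℝ) : axisRotation b a ∈ specialQubitGates := by
  have h : (Complex.cos a) ^ 2 + (Complex.sin a) ^ 2 = 1 := by
    rw [add_comm]; exact Complex.sin_sq_add_cos_sq _
  have hI := Complex.I_sq
  have hs : starRingEnd ℂ (Complex.sin a) = Complex.sin a := by
    rw [← Complex.ofReal_sin]; exact Complex.conj_ofReal _
  refine Matrix.mem_specialUnitaryGroup_iff.2 ⟨Matrix.mem_unitaryGroup_iff.2 ?_, ?_⟩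
  · ext i j
    cases b <;> fin_cases i <;> fin_cases j <;>
      simp [axisRotation, pauli, Matrix.mul_apply, Fin.sum_univ_two, Matrix.star_apply,
        Matrix.add_apply, hs] <;>
      grind
  · cases b <;> simp [axisRotation, pauli, Matrix.det_fin_two] <;> grind

/-- The rotations about the horizontal axes. -/
noncomputable def horizontalRotation (c t : ℝ) : QubitMatrix :=
  Real.cos c • (1 : QubitMatrix) + (Real.sin c * Real.cos t) • !![0, -1; 1, 0] +
    (Real.sin c * Real.sin t) • !![0, Complex.I; Complex.I, 0]

/-- An element of `SU(2)` is determined by its first column `(α, β)`. The angle `a` is the argument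
of `α`, and `c` encodes the moduli. The diagonal factor multiplies the lower row by `e^{-ia}`,
whence `t = arg β + a`. -/
lemma exists_axisRotation_mul_horizontalRotation {u : QubitMatrix} (hu : u ∈ specialQubitGates) :
    ∃ a c t : ℝ, u = axisRotation false a * horizontalRotation c t := by
  obtain ⟨h1, hd⟩ := Matrix.mem_specialUnitaryGroup_iff.1 hu
  have hinv : star u = u.adjugate := by
    have h2 := Matrix.mem_unitaryGroup_iff'.1 h1
    have h3 : u * u.adjugate = 1 := by rw [Matrix.mul_adjugate, hd, one_smul]
    calc star u = star u * (u * u.adjugate) := by rw [h3, mul_one]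
      _ = u.adjugate := by rw [← mul_assoc, h2, one_mul]
  have h11 : u 1 1 = starRingEnd ℂ (u 0 0) := by
    have := congrFun (congrFun hinv 0) 0
    simpa [Matrix.adjugate_fin_two, Matrix.star_apply] using this.symm
  have h01 : u 0 1 = - starRingEnd ℂ (u 1 0) := by
    have := congrFun (congrFun hinv 0) 1
    simp [Matrix.adjugate_fin_two, Matrix.star_apply] at this
    rw [this, neg_neg]
  have hn : ‖u 0 0‖ ^ 2 + ‖u 1 0‖ ^ 2 = 1 := by
    rw [Matrix.det_fin_two, h11, h01, Complex.mul_conj, neg_mul, mul_comm (starRingEnd ℂ _),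
      Complex.mul_conj] at hd
    rw [← Complex.normSq_eq_norm_sq, ← Complex.normSq_eq_norm_sq]
    have : ((Complex.normSq (u 0 0) + Complex.normSq (u 1 0) : ℝ) : ℂ) = 1 := by
      push_cast; linear_combination hd
    exact_mod_cast this
  obtain ⟨c, hc, hs⟩ : ∃ c : ℝ, Real.cos c = ‖u 0 0‖ ∧ Real.sin c = ‖u 1 0‖ := by
    refine ⟨Real.arccos ‖u 0 0‖, Real.cos_arccos ?_ ?_, ?_⟩
    · linarith [norm_nonneg (u 0 0)]
    · nlinarith [norm_nonneg (u 0 0), sq_nonneg ‖u 1 0‖]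
    · rw [Real.sin_arccos, show 1 - ‖u 0 0‖ ^ 2 = ‖u 1 0‖ ^ 2 by linarith,
        Real.sqrt_sq (norm_nonneg _)]
  set a := (u 0 0).arg with ha
  set t := (u 1 0).arg + a with ht
  have e0 : u 0 0 = Real.cos c * (Complex.cos a + Complex.sin a * Complex.I) := by
    rw [hc]; exact (Complex.norm_mul_cos_add_sin_mul_I _).symm
  have e1 : u 1 0 = Real.sin c * ((Complex.cos a - Complex.sin a * Complex.I) *
      (Complex.cos t + Complex.sin t * Complex.I)) := by
    rw [hs]
    conv_lhs => rw [← Complex.norm_mul_cos_add_sin_mul_I (u 1 0)]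
    have h3 : (((u 1 0).arg : ℝ) : ℂ) = t - a := by rw [ht]; push_cast; ring
    rw [h3, Complex.cos_sub, Complex.sin_sub]
    have hI := Complex.I_sq
    congr 1
    linear_combination (Complex.sin a * Complex.sin t) * hI
  have conj_cos (x : ℝ) : starRingEnd ℂ (Complex.cos x) = Complex.cos x := by
    rw [← Complex.ofReal_cos]; exact Complex.conj_ofReal _
  have conj_sin (x : ℝ) : starRingEnd ℂ (Complex.sin x) = Complex.sin x := by
    rw [← Complex.ofReal_sin]; exact Complex.conj_ofReal _
  have hI := Complex.I_sq
  refine ⟨a, c, t, ?_⟩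
  ext i j
  fin_cases i <;> fin_cases j
  · simp [axisRotation, horizontalRotation, pauli, Matrix.mul_apply, Fin.sum_univ_two, e0]
    ring
  · simp [axisRotation, horizontalRotation, pauli, Matrix.mul_apply, Fin.sum_univ_two, h01, e1,
      conj_cos, conj_sin]
    ring
  · simp [axisRotation, horizontalRotation, pauli, Matrix.mul_apply, Fin.sum_univ_two, e1]
    ring
  · simp [axisRotation, horizontalRotation, pauli, Matrix.mul_apply, Fin.sum_univ_two, h11, e0,
      conj_cos, conj_sin]
    ring

/-- The Hadamard matrix. -/
noncomputable def hadamardGate : QubitMatrix :=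
  ((Real.sqrt 2)⁻¹ : ℝ) • !![1, 1; 1, -1]

lemma hadamardGate_mul_self : hadamardGate * hadamardGate = 1 := by
  have h2 : ((Real.sqrt 2 : ℝ) : ℂ) * (Real.sqrt 2 : ℝ) = 2 := by
    rw [← Complex.ofReal_mul, Real.mul_self_sqrt (by norm_num)]; norm_num
  have h0 : ((Real.sqrt 2 : ℝ) : ℂ) ≠ 0 := by
    intro h; rw [h] at h2; norm_num at h2
  ext i j
  fin_cases i <;> fin_cases j <;>
    simp [hadamardGate, Matrix.mul_apply, Fin.sum_univ_two] <;>
    field_simp <;> linear_combination -h2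

lemma hadamardGate_star : star hadamardGate = hadamardGate := by
  ext i j
  fin_cases i <;> fin_cases j <;> simp [hadamardGate, Matrix.star_apply]

lemma hadamardGate_mul_pauli_mul :
    hadamardGate * pauli false * hadamardGate = pauli true := by
  have h : hadamardGate * pauli false = pauli true * hadamardGate := by
    ext i j
    fin_cases i <;> fin_cases j <;>
      simp [hadamardGate, pauli, Matrix.mul_apply, Fin.sum_univ_two]
  rw [h, mul_assoc, hadamardGate_mul_self, mul_one]

lemma hadamardGate_conj_mem {u : QubitMatrix} (hu : u ∈ specialQubitGates) :
    hadamardGate * u * hadamardGate ∈ specialQubitGates := by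
  obtain ⟨h1, hd⟩ := Matrix.mem_specialUnitaryGroup_iff.1 hu
  have hH : hadamardGate ∈ Matrix.unitaryGroup (Fin 2) ℂ :=
    Matrix.mem_unitaryGroup_iff.2 (by rw [hadamardGate_star, hadamardGate_mul_self])
  refine Matrix.mem_specialUnitaryGroup_iff.2 ⟨mul_mem (mul_mem hH h1) hH, ?_⟩
  rw [Matrix.det_mul, Matrix.det_mul, hd, mul_one, ← Matrix.det_mul, hadamardGate_mul_self,
    Matrix.det_one]

/-- Representatives of the single-qubit gates modulo the rotations about one axis. -/
noncomputable def axisComplement (b : Bool) : Set QubitMatrix :=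
  Set.range fun x : Fin 2 → ℝ =>
    if b then hadamardGate * horizontalRotation (x 0) (x 1) * hadamardGate
    else horizontalRotation (x 0) (x 1)

lemma isSmoothlyParametrized_axisRotation (b : Bool) :
    IsSmoothlyParametrized 1 (Set.range (axisRotation b)) := by
  refine ⟨fun x => axisRotation b (x 0), ?_, ?_⟩
  · unfold axisRotation; fun_prop
  · rintro _ ⟨a, rfl⟩
    exact ⟨fun _ => a, rfl⟩

lemma isSmoothlyParametrized_axisComplement (b : Bool) :
    IsSmoothlyParametrized 2 (axisComplement b) := by
  refine ⟨_, ?_, subset_rfl⟩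
  cases b <;> simp only [Bool.false_eq_true, if_true, if_false]
  · unfold horizontalRotation; fun_prop
  · refine (contDiff_const.mul ?_).mul contDiff_const
    unfold horizontalRotation; fun_prop

/-- The X-axis case reduces to the Z-axis case by Hadamard conjugation, which exchanges the two
axes. -/
lemma specialQubitGates_subset (b : Bool) :
    specialQubitGates ⊆ Set.range (axisRotation b) * axisComplement b := by
  intro u hu
  cases b
  · obtain ⟨a, c, t, h⟩ := exists_axisRotation_mul_horizontalRotation hu
    exact ⟨_, ⟨a, rfl⟩, _, ⟨![c, t], rfl⟩, by simpa using h.symm⟩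
  · obtain ⟨a, c, t, h⟩ := exists_axisRotation_mul_horizontalRotation (hadamardGate_conj_mem hu)
    refine ⟨_, ⟨a, rfl⟩, _, ⟨![c, t], rfl⟩, ?_⟩
    have h1 : axisRotation true a = hadamardGate * axisRotation false a * hadamardGate := by
      rw [axisRotation, axisRotation, ← hadamardGate_mul_pauli_mul, mul_add, add_mul]
      simp [hadamardGate_mul_self]
    have h2 (v w : QubitMatrix) : hadamardGate * v * hadamardGate *
        (hadamardGate * w * hadamardGate) = hadamardGate * (v * w) * hadamardGate := by
      calc _ = hadamardGate * v * (hadamardGate * hadamardGate) * w * hadamardGate := by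
            simp only [mul_assoc]
        _ = _ := by rw [hadamardGate_mul_self]; simp only [mul_assoc, one_mul]
    simp only [if_true, h1, Matrix.cons_val_zero, Matrix.cons_val_one, h2, ← h]
    calc _ = (hadamardGate * hadamardGate) * u * (hadamardGate * hadamardGate) := by
          simp only [mul_assoc]
      _ = u := by rw [hadamardGate_mul_self, one_mul, mul_one]

lemma isSmoothlyParametrized_specialQubitGates :
    IsSmoothlyParametrized 3 specialQubitGates :=
  ((isSmoothlyParametrized_axisRotation false).mul
    (isSmoothlyParametrized_axisComplement false)).mono (specialQubitGates_subset false)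

/-! ### Gates on one wire and their commutation with CNOT -/

/-- The two-qubit matrix acting as `u` on one wire and trivially on the other. -/
noncomputable def onWire : Fin 2 → QubitMatrix → TwoQubitMatrix
  | 0, u => u ⊗ₖ 1
  | 1, u => 1 ⊗ₖ u

lemma onWire_one (w : Fin 2) : onWire w 1 = 1 := by
  match w with
  | 0 => exact Matrix.one_kronecker_one
  | 1 => exact Matrix.one_kronecker_one

lemma onWire_mul (w : Fin 2) (u v : QubitMatrix) :
    onWire w (u * v) = onWire w u * onWire w v := by
  match w with
  | 0 => simp [onWire, ← Matrix.mul_kronecker_mul]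
  | 1 => simp [onWire, ← Matrix.mul_kronecker_mul]

lemma onWire_add (w : Fin 2) (u v : QubitMatrix) :
    onWire w (u + v) = onWire w u + onWire w v := by
  match w with
  | 0 => exact Matrix.add_kronecker _ _ _
  | 1 => exact Matrix.kronecker_add _ _ _

lemma onWire_smul {R : Type*} [SMul R ℂ] [IsScalarTower R ℂ ℂ] [SMulCommClass R ℂ ℂ]
    (w : Fin 2) (a : R) (u : QubitMatrix) : onWire w (a • u) = a • onWire w u := by
  match w with
  | 0 => exact Matrix.smul_kronecker _ _ _
  | 1 => exact Matrix.kronecker_smul _ _ _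

lemma onWire_comm (u v : QubitMatrix) : Commute (onWire 0 u) (onWire 1 v) := by
  simp [Commute, SemiconjBy, onWire, ← Matrix.mul_kronecker_mul]

lemma onWire_det {u : QubitMatrix} (hu : u ∈ specialQubitGates) (w : Fin 2) :
    (onWire w u).det = 1 := by
  have h := (Matrix.mem_specialUnitaryGroup_iff.1 hu).2
  match w with
  | 0 => simp [onWire, Matrix.det_kronecker, h]
  | 1 => simp [onWire, Matrix.det_kronecker, h]

lemma contDiff_onWire (w : Fin 2) : ContDiff ℝ 1 (onWire w) :=
  (LinearMap.toContinuousLinearMap (𝕜 := ℝ)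
    { toFun := onWire w, map_add' := onWire_add w, map_smul' := onWire_smul w }).contDiff

lemma BasicGate.oneQubit_toMatrix (w : Fin 2) (u : Matrix.unitaryGroup (Fin 2) ℂ) :
    (BasicGate.oneQubit w u).toMatrix = onWire w u := by
  match w with
  | 0 => rfl
  | 1 => rfl

lemma BasicGate.cnot_mul_self (i : Fin 2) :
    (BasicGate.cnot i).toMatrix * (BasicGate.cnot i).toMatrix = 1 := by
  ext ⟨a, b⟩ ⟨c, d⟩
  match i with
  | 0 => fin_cases a <;> fin_cases b <;> fin_cases c <;> fin_cases d <;>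
      simp [toMatrix, Matrix.mul_apply]
  | 1 => fin_cases a <;> fin_cases b <;> fin_cases c <;> fin_cases d <;>
      simp [toMatrix, Matrix.mul_apply]

/-- A CNOT preserves the control bit, hence commutes with Z there, and acts on the target by powers
of X. Every saved parameter comes from this. -/
lemma BasicGate.commute_cnot_pauli (i w : Fin 2) :
    Commute (BasicGate.cnot i).toMatrix (onWire w (pauli (decide (w ≠ i)))) := by
  ext ⟨a, b⟩ ⟨c, d⟩
  match i, w with
  | 0, 0 | 0, 1 | 1, 0 | 1, 1 =>
    fin_cases a <;> fin_cases b <;> fin_cases c <;> fin_cases d <;>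
      simp [toMatrix, pauli, onWire, Matrix.mul_apply, Fintype.sum_prod_type,
        Matrix.kroneckerMap_apply]

lemma BasicGate.commute_cnot_axisRotation (i w : Fin 2) (a : ℝ) :
    Commute (BasicGate.cnot i).toMatrix (onWire w (axisRotation (decide (w ≠ i)) a)) := by
  rw [axisRotation, onWire_add, onWire_smul, onWire_smul, onWire_smul, onWire_one]
  exact ((Commute.one_right _).smul_right _).add_right
    (((commute_cnot_pauli i w).smul_right _).smul_right _)

/-! ### Circuit shapes and their parametrization -/

/-- The determinant-one gates on a wire, or the identity if the slot is empty. -/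
noncomputable def slotGates (w : Fin 2) (q : Bool) : Set TwoQubitMatrix :=
  if q then onWire w '' specialQubitGates else {1}

/-- Representatives of the gates of a slot: modulo the rotations that commute with the
controlled-not with control `i`, if the slot on the other side of it is filled as well. -/
noncomputable def reducedSlotGates (i w : Fin 2) (q q' : Bool) : Set TwoQubitMatrix :=
  if q && q' then onWire w '' axisComplement (decide (w ≠ i)) else slotGates w q

/-- The number of parameters of a slot. -/
def slotDim (q : Bool) : ℕ := if q then 3 else 0

/-- The number of parameters of a slot next to another slot of the same wire. -/
def reducedSlotDim (q q' : Bool) : ℕ := if q && q' then 2 else slotDim q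

lemma one_mem_slotGates (w : Fin 2) (q : Bool) : 1 ∈ slotGates w q := by
  cases q
  · simp [slotGates]
  · exact ⟨1, one_mem_specialQubitGates, onWire_one w⟩

lemma slotGates_subset_range (w : Fin 2) (q : Bool) : slotGates w q ⊆ Set.range (onWire w) := by
  cases q
  · rintro _ rfl
    exact ⟨1, onWire_one w⟩
  · exact Set.image_subset_range _ _

lemma reducedSlotGates_subset_range (i w : Fin 2) (q q' : Bool) :
    reducedSlotGates i w q q' ⊆ Set.range (onWire w) := by
  unfold reducedSlotGates
  split_ifs
  · exact Set.image_subset_range _ _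
  · exact slotGates_subset_range w q

lemma slotGates_mul {w : Fin 2} {q q' : Bool} {x y : TwoQubitMatrix}
    (hx : x ∈ slotGates w q) (hy : y ∈ slotGates w q') : x * y ∈ slotGates w (q || q') := by
  cases q
  · obtain rfl : x = 1 := hx
    simpa using hy
  · cases q'
    · obtain rfl : y = 1 := hy
      simpa using hx
    · obtain ⟨u, hu, rfl⟩ := hx
      obtain ⟨v, hv, rfl⟩ := hy
      exact ⟨u * v, specialQubitGates_mul_self ▸ Set.mul_mem_mul hu hv, onWire_mul w u v⟩

/-- The factor `t` is what can be moved across the CNOT and absorbed by the slot on the other side.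
If that slot is empty nothing can be absorbed, and `t = 1`. -/
lemma exists_eq_mul_reducedSlotGates (i w : Fin 2) (q q' : Bool) {y : TwoQubitMatrix}
    (hy : y ∈ slotGates w q) :
    ∃ t ∈ slotGates w q', Commute (BasicGate.cnot i).toMatrix t ∧
      ∃ v ∈ reducedSlotGates i w q q', y = t * v := by
  by_cases h : (q && q') = true
  · obtain ⟨rfl, rfl⟩ : q = true ∧ q' = true := by simpa using h
    obtain ⟨u, hu, rfl⟩ := hy
    obtain ⟨_, ⟨a, rfl⟩, v, hv, rfl⟩ := specialQubitGates_subset (decide (w ≠ i)) hu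
    exact ⟨_, ⟨_, axisRotation_mem _ a, rfl⟩, BasicGate.commute_cnot_axisRotation i w a,
      _, ⟨v, hv, rfl⟩, onWire_mul w _ _⟩
  · refine ⟨1, one_mem_slotGates w q', Commute.one_right _, y, ?_, (one_mul y).symm⟩
    rwa [reducedSlotGates, if_neg h]

lemma isSmoothlyParametrized_slotGates (w : Fin 2) (q : Bool) :
    IsSmoothlyParametrized (slotDim q) (slotGates w q) := by
  cases q
  · exact .singleton 1
  · exact isSmoothlyParametrized_specialQubitGates.image (contDiff_onWire w)

lemma isSmoothlyParametrized_reducedSlotGates (i w : Fin 2) (q q' : Bool) :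
    IsSmoothlyParametrized (reducedSlotDim q q') (reducedSlotGates i w q q') := by
  unfold reducedSlotDim reducedSlotGates
  split_ifs
  · exact (isSmoothlyParametrized_axisComplement _).image (contDiff_onWire w)
  · exact isSmoothlyParametrized_slotGates w q

/-- The products of the gates in two parallel slots. -/
noncomputable def blockGates (p : Fin 2 → Bool) : Set TwoQubitMatrix :=
  slotGates 0 (p 0) * slotGates 1 (p 1)

lemma commute_of_mem_range {x y : TwoQubitMatrix} (hx : x ∈ Set.range (onWire 0))
    (hy : y ∈ Set.range (onWire 1)) : Commute x y := by
  obtain ⟨u, rfl⟩ := hx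
  obtain ⟨v, rfl⟩ := hy
  exact onWire_comm u v

lemma blockGates_mul_slotGates {p : Fin 2 → Bool} {w : Fin 2} {q : Bool} {x y : TwoQubitMatrix}
    (hx : x ∈ blockGates p) (hy : y ∈ slotGates w q) :
    x * y ∈ blockGates (Function.update p w (p w || q)) := by
  obtain ⟨a, ha, b, hb, rfl⟩ := hx
  match w with
  | 0 =>
    refine ⟨a * y, slotGates_mul ha hy, b, hb, ?_⟩
    have := commute_of_mem_range (slotGates_subset_range _ _ hy) (slotGates_subset_range _ _ hb)
    simp only [mul_assoc, this.eq]
  | 1 => exact ⟨a, ha, b * y, slotGates_mul hb hy, (mul_assoc a b y).symm⟩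

/-- The operators of the circuits of a given shape, later gates to the left: the last block `p` of
one-qubit gates in matrix order, preceded by alternating blocks and controlled-nots. -/
noncomputable def wordGates : (Fin 2 → Bool) → List (Fin 2 × (Fin 2 → Bool)) → Set TwoQubitMatrix
  | p, [] => blockGates p
  | p, (i, p') :: r => wordGates p' r * {(BasicGate.cnot i).toMatrix} * blockGates p

/-- The number of parameters needed for the circuits of a given shape. -/
def wordDim : (Fin 2 → Bool) → List (Fin 2 × (Fin 2 → Bool)) → ℕ
  | p, [] => slotDim (p 0) + slotDim (p 1)
  | p, (_, p') :: r =>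
      wordDim p' r + (reducedSlotDim (p 0) (p' 0) + reducedSlotDim (p 1) (p' 1))

/-- The number of filled slots in a shape. -/
def wordWeight : (Fin 2 → Bool) → List (Fin 2 × (Fin 2 → Bool)) → ℕ
  | p, [] => (p 0).toNat + (p 1).toNat
  | p, (_, p') :: r => wordWeight p' r + ((p 0).toNat + (p 1).toNat)

lemma wordGates_mul_slotGates {p : Fin 2 → Bool} {r : List (Fin 2 × (Fin 2 → Bool))} {w : Fin 2}
    {q : Bool} {x y : TwoQubitMatrix} (hx : x ∈ wordGates p r) (hy : y ∈ slotGates w q) :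
    x * y ∈ wordGates (Function.update p w (p w || q)) r := by
  match r with
  | [] => exact blockGates_mul_slotGates hx hy
  | (i, p') :: r =>
    obtain ⟨a, ha, b, hb, rfl⟩ := hx
    exact ⟨a, ha, b * y, blockGates_mul_slotGates hb hy, (mul_assoc a b y).symm⟩

/-- Induction from the left end of the product: the rotations split off from the rightmost block are
pushed left through the CNOT into the shorter word, whose shape does not change because they enter
filled slots or are trivial. -/
lemma isSmoothlyParametrized_wordGates (p : Fin 2 → Bool) (r : List (Fin 2 × (Fin 2 → Bool))) :
    IsSmoothlyParametrized (wordDim p r) (wordGates p r) := by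
  induction r generalizing p with
  | nil => exact (isSmoothlyParametrized_slotGates 0 _).mul (isSmoothlyParametrized_slotGates 1 _)
  | cons ip r ih =>
    obtain ⟨i, p'⟩ := ip
    refine IsSmoothlyParametrized.mono (((ih p').mul (.singleton (BasicGate.cnot i).toMatrix)).mul
      ((isSmoothlyParametrized_reducedSlotGates i 0 (p 0) (p' 0)).mul
        (isSmoothlyParametrized_reducedSlotGates i 1 (p 1) (p' 1)))) ?_
    rintro _ ⟨_, ⟨x, hx, _, rfl, rfl⟩, _, ⟨y₀, hy₀, y₁, hy₁, rfl⟩, rfl⟩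
    obtain ⟨t₀, ht₀, hc₀, v₀, hv₀, rfl⟩ := exists_eq_mul_reducedSlotGates i 0 _ (p' 0) hy₀
    obtain ⟨t₁, ht₁, hc₁, v₁, hv₁, rfl⟩ := exists_eq_mul_reducedSlotGates i 1 _ (p' 1) hy₁
    have hx' : x * t₀ * t₁ ∈ wordGates p' r := by
      have h := wordGates_mul_slotGates (wordGates_mul_slotGates hx ht₀)
        (w := 1) (q := p' 1) ht₁
      simpa using h
    have hvt := commute_of_mem_range (reducedSlotGates_subset_range i 0 _ _ hv₀)
      (slotGates_subset_range _ _ ht₁)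
    refine ⟨_, ⟨_, hx', _, rfl, rfl⟩, _, ⟨v₀, hv₀, v₁, hv₁, rfl⟩, ?_⟩
    simp only
    calc x * t₀ * t₁ * (BasicGate.cnot i).toMatrix * (v₀ * v₁)
        = x * (t₀ * (t₁ * (BasicGate.cnot i).toMatrix)) * (v₀ * v₁) := by simp only [mul_assoc]
      _ = x * (t₀ * (BasicGate.cnot i).toMatrix) * (t₁ * v₀) * v₁ := by
          rw [← hc₁.eq]; simp only [mul_assoc]
      _ = x * (BasicGate.cnot i).toMatrix * (t₀ * v₀ * (t₁ * v₁)) := by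
          rw [← hc₀.eq, ← hvt.eq]; simp only [mul_assoc]

/-- One-qubit factors have determinant 1, and a CNOT is an involution. This is what makes the phase
discrete. -/
lemma det_sq_of_mem_wordGates {p : Fin 2 → Bool} {r : List (Fin 2 × (Fin 2 → Bool))}
    {x : TwoQubitMatrix} (hx : x ∈ wordGates p r) : x.det ^ 2 = 1 := by
  have slot {w : Fin 2} {q : Bool} {y : TwoQubitMatrix} (hy : y ∈ slotGates w q) : y.det = 1 := by
    cases q
    · obtain rfl : y = 1 := hy
      exact Matrix.det_one
    · obtain ⟨u, hu, rfl⟩ := hy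
      exact onWire_det hu w
  have block {p : Fin 2 → Bool} {y : TwoQubitMatrix} (hy : y ∈ blockGates p) : y.det = 1 := by
    obtain ⟨a, ha, b, hb, rfl⟩ := hy
    rw [Matrix.det_mul, slot ha, slot hb, one_mul]
  induction r generalizing p x with
  | nil => rw [block hx, one_pow]
  | cons ip r ih =>
    obtain ⟨_, ⟨a, ha, _, rfl, rfl⟩, b, hb, rfl⟩ := hx
    have h := congrArg Matrix.det (BasicGate.cnot_mul_self ip.1)
    rw [Matrix.det_mul, Matrix.det_one, ← pow_two] at h
    rw [Matrix.det_mul, Matrix.det_mul, block hb, mul_one, mul_pow, ih ha, h, mul_one]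

/-! ### From circuits to shapes -/

lemma exists_smul_mem_specialQubitGates (u : Matrix.unitaryGroup (Fin 2) ℂ) :
    ∃ z : ℂ, ∃ v ∈ specialQubitGates, (u : QubitMatrix) = z • v := by
  -- Dividing by a square root of the determinant normalizes the gate.
  obtain ⟨z, hz⟩ := IsAlgClosed.exists_pow_nat_eq (u : QubitMatrix).det (n := 2) (by norm_num)
  have hd : ‖(u : QubitMatrix).det‖ = 1 :=
    CStarRing.norm_of_mem_unitary (Matrix.det_of_mem_unitary u.2)
  have hz1 : ‖z‖ = 1 := by
    rw [← hz, norm_pow] at hd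
    exact (pow_eq_one_iff_of_nonneg (norm_nonneg z) (by norm_num)).1 hd
  have hz0 : z ≠ 0 := by rintro rfl; simp at hz1
  refine ⟨z, z⁻¹ • (u : QubitMatrix), ?_, by rw [smul_smul, mul_inv_cancel₀ hz0, one_smul]⟩
  refine Matrix.mem_specialUnitaryGroup_iff.2 ⟨Matrix.mem_unitaryGroup_iff.2 ?_, ?_⟩
  · have hzz : z⁻¹ * star z⁻¹ = 1 := by
      rw [Complex.star_def, Complex.mul_conj, Complex.normSq_eq_norm_sq, norm_inv, hz1]; simp
    rw [star_smul, smul_mul_smul_comm, hzz, Matrix.mem_unitaryGroup_iff.1 u.2, one_smul]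
  · rw [Matrix.det_smul, Fintype.card_fin, ← hz, ← mul_pow, inv_mul_cancel₀ hz0, one_pow]

/-- The head of the list acts first, so it is the rightmost factor: a CNOT opens a new empty block,
and a one-qubit gate merges into the current block, filling at most one new slot. -/
lemma BasicCircuit.exists_eval_eq_smul (c : BasicCircuit) :
    ∃ z : ℂ, ∃ p r, ∃ x ∈ wordGates p r, eval c = z • x ∧ r.length = cnotCount c ∧
      r.length + wordWeight p r ≤ gateCount c := by
  induction c with
  | nil =>
    refine ⟨1, fun _ => false, [], 1, ?_, by simp [eval], rfl, le_rfl⟩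
    exact ⟨1, one_mem_slotGates _ _, 1, one_mem_slotGates _ _, one_mul 1⟩
  | cons g c ih =>
    obtain ⟨z, p, r, x, hx, he, hl, hw⟩ := ih
    cases g with
    | cnot i =>
      refine ⟨z, fun _ => false, (i, p) :: r, x * (BasicGate.cnot i).toMatrix, ?_, ?_, ?_, ?_⟩
      · exact ⟨_, ⟨x, hx, _, rfl, rfl⟩, 1,
          ⟨1, one_mem_slotGates _ _, 1, one_mem_slotGates _ _, one_mul 1⟩, mul_one _⟩
      · rw [eval, he, smul_mul_assoc]
      · rw [List.length_cons, hl]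
        exact (List.countP_cons_of_pos rfl).symm
      · simp only [gateCount, wordWeight, List.length_cons, Bool.toNat_false] at hw ⊢
        omega
    | oneQubit w u =>
      obtain ⟨y, v, hv, hu⟩ := exists_smul_mem_specialQubitGates u
      refine ⟨z * y, Function.update p w (p w || true), r, x * onWire w v,
        wordGates_mul_slotGates hx ⟨v, hv, rfl⟩, ?_, ?_, ?_⟩
      · rw [eval, he, BasicGate.oneQubit_toMatrix, hu, onWire_smul, smul_mul_smul_comm]
      · simpa [cnotCount, BasicGate.isCNOT] using hl
      · have hb (b : Bool) : b.toNat ≤ 1 := b.toNat_le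
        have key : wordWeight (Function.update p w (p w || true)) r ≤ wordWeight p r + 1 := by
          have h0 := hb (p 0)
          have h1 := hb (p 1)
          match w, r with
          | 0, [] | 1, [] | 0, _ :: _ | 1, _ :: _ => simp [wordWeight]; try omega
        simp only [gateCount, List.length_cons] at hw ⊢
        omega

/-- With `k ≤ 2` CNOTs each wire has at most `3 + 2k ≤ 7` parameters. With three CNOTs at most five
slots are filled, giving `2 * 5 + 2 + 2 = 14`. With four or more, at most four slots are filled,
giving at most 12. -/
lemma wordDim_le (p : Fin 2 → Bool) (r : List (Fin 2 × (Fin 2 → Bool)))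
    (h : r.length ≤ 2 ∨ r.length + wordWeight p r ≤ 8) : wordDim p r ≤ 14 := by
  have slot (q : Bool) : slotDim q = 3 * q.toNat := by cases q <;> rfl
  have reduced (q q' : Bool) : reducedSlotDim q q' ≤ 3 * q.toNat := by
    cases q <;> cases q' <;> decide
  have general (p : Fin 2 → Bool) (r : List (Fin 2 × (Fin 2 → Bool))) :
      wordDim p r ≤ 3 * wordWeight p r := by
    induction r generalizing p with
    | nil => simp only [wordDim, wordWeight, slot]; omega
    | cons ip r ih =>
      have h0 := reduced (p 0) (ip.2 0)
      have h1 := reduced (p 1) (ip.2 1)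
      have h2 := ih ip.2
      simp only [wordDim, wordWeight]
      omega
  have one : ∀ a : Bool, slotDim a ≤ 7 := by decide
  have two : ∀ a b : Bool, slotDim b + reducedSlotDim a b ≤ 7 := by decide
  have three : ∀ a b c : Bool,
      slotDim c + reducedSlotDim b c + reducedSlotDim a b ≤ 7 := by decide
  -- A maximal run of `n` filled slots on a wire needs `2 * n + 1` parameters, and four consecutive
  -- slots contain at most two runs.
  have four : ∀ a b c d : Bool,
      slotDim d + reducedSlotDim c d + reducedSlotDim b c + reducedSlotDim a b ≤
        2 * (a.toNat + b.toNat + c.toNat + d.toNat) + 2 := by decide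
  have four' : ∀ a b c d : Bool,
      slotDim d + reducedSlotDim c d + reducedSlotDim b c + reducedSlotDim a b ≤
        3 * (a.toNat + b.toNat + c.toNat + d.toNat) := by decide
  match r, h with
  | [], _ =>
    have h0 := one (p 0)
    have h1 := one (p 1)
    simp only [wordDim]
    omega
  | [(_, p₁)], _ =>
    have h0 := two (p 0) (p₁ 0)
    have h1 := two (p 1) (p₁ 1)
    simp only [wordDim]
    omega
  | [(_, p₁), (_, p₂)], _ =>
    have h0 := three (p 0) (p₁ 0) (p₂ 0)
    have h1 := three (p 1) (p₁ 1) (p₂ 1)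
    simp only [wordDim]
    omega
  | [(_, p₁), (_, p₂), (_, p₃)], h =>
    have h0 := four (p 0) (p₁ 0) (p₂ 0) (p₃ 0)
    have h1 := four (p 1) (p₁ 1) (p₂ 1) (p₃ 1)
    have h0' := four' (p 0) (p₁ 0) (p₂ 0) (p₃ 0)
    have h1' := four' (p 1) (p₁ 1) (p₂ 1) (p₃ 1)
    simp only [wordDim, wordWeight, List.length_cons, List.length_nil] at h ⊢
    omega
  | _ :: _ :: _ :: _ :: r, h =>
    refine (general _ _).trans ?_
    simp only [List.length_cons] at h
    omega

/-! ### A chart of `SU(4)` of dimension at least 15 -/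

lemma Matrix.det_exp_of_mem_skewAdjoint {ι : Type*} [Fintype ι] [DecidableEq ι] {X : Matrix ι ι ℂ}
    (hX : star X = -X) (ht : X.trace = 0) : (NormedSpace.exp X).det = 1 := by
  -- The matrix `iX` is Hermitian, so `X` is diagonalizable and the determinant of its exponential
  -- is the exponential of its trace.
  have hH : (Complex.I • X).IsHermitian := by
    rw [Matrix.IsHermitian, ← Matrix.star_eq_conjTranspose, star_smul, hX]
    simp
  have hsum : ∑ i, (hH.eigenvalues i : ℂ) = 0 := by
    have h := hH.trace_eq_sum_eigenvalues
    rw [Matrix.trace_smul, ht, smul_zero] at h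
    exact h.symm
  let U : Matrix ι ι ℂ := (hH.eigenvectorUnitary : Matrix ι ι ℂ)
  have hUU : U * star U = 1 := Matrix.mem_unitaryGroup_iff.1 hH.eigenvectorUnitary.2
  have hinv : U⁻¹ = star U := Matrix.inv_eq_right_inv hUU
  have hunit : IsUnit U := IsUnit.of_mul_eq_one _ hUU
  have hspec := hH.spectral_theorem
  rw [Unitary.conjStarAlgAut_apply] at hspec
  have hX' : X = U * Matrix.diagonal (fun i => -Complex.I * hH.eigenvalues i) * U⁻¹ := by
    have h1 : -Complex.I • (Complex.I • X) = X := by simp [smul_smul]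
    have h2 : Matrix.diagonal (fun i => -Complex.I * (hH.eigenvalues i : ℂ)) =
        -Complex.I • Matrix.diagonal (RCLike.ofReal ∘ hH.eigenvalues) := by
      rw [← Matrix.diagonal_smul]
      rfl
    rw [h2, hinv, Matrix.mul_smul, Matrix.smul_mul]
    exact h1.symm.trans (congrArg (fun Y => -Complex.I • Y) hspec)
  rw [hX', Matrix.exp_conj _ _ hunit, Matrix.exp_diagonal, Matrix.det_conj hunit,
    Matrix.det_diagonal]
  simp only [Pi.coe_exp, ← Complex.exp_eq_exp_ℂ, ← Complex.exp_sum, ← Finset.mul_sum, hsum, mul_zero,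
    Complex.exp_zero]

/-- The traceless skew-Hermitian matrices form a real vector space of dimension at least `15`. -/
lemma exists_injective_skewHermitian :
    ∃ n : ℕ, 15 ≤ n ∧ ∃ Φ : (Fin n → ℝ) →ₗ[ℝ] TwoQubitMatrix, Function.Injective Φ ∧
      ∀ x, star (Φ x) = -Φ x ∧ (Φ x).trace = 0 := by
  let T : Matrix (Fin 2 × Fin 2) (Fin 2 × Fin 2) ℝ →ₗ[ℝ] ℝ := Matrix.traceLinearMap _ ℝ ℝ
  let E := LinearMap.ker T
  have hE : 15 ≤ Module.finrank ℝ E := by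
    have h1 := T.finrank_range_add_finrank_ker
    have h2 : Module.finrank ℝ (LinearMap.range T) ≤ 1 :=
      (Submodule.finrank_le _).trans (by simp)
    have h3 : Module.finrank ℝ (Matrix (Fin 2 × Fin 2) (Fin 2 × Fin 2) ℝ) = 16 := by
      simp [Module.finrank_matrix]
    have h4 : Module.finrank ℝ E = Module.finrank ℝ (LinearMap.ker T) := rfl
    omega
  -- The map `A ↦ (A - Aᵀ) + i(A + Aᵀ)` sends real matrices injectively to skew-Hermitian ones and
  -- multiplies the trace by `2i`.
  let Ψ : Matrix (Fin 2 × Fin 2) (Fin 2 × Fin 2) ℝ →ₗ[ℝ] TwoQubitMatrix :=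
    { toFun := fun A => Matrix.of fun j k =>
        ((A j k - A k j : ℝ) : ℂ) + ((A j k + A k j : ℝ) : ℂ) * Complex.I
      map_add' := fun A B => by
        ext j k
        simp
        ring
      map_smul' := fun a A => by
        ext j k
        simp
        ring }
  let e := (Module.finBasis ℝ E).equivFun.symm
  refine ⟨Module.finrank ℝ E, hE, Ψ ∘ₗ E.subtype ∘ₗ e.toLinearMap, ?_, fun x => ⟨?_, ?_⟩⟩
  · have hΨ : Function.Injective Ψ := by
      rw [injective_iff_map_eq_zero]
      intro A hA
      ext j k
      have h := congrFun (congrFun hA j) k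
      have hre := congrArg Complex.re h
      have him := congrArg Complex.im h
      simp [Ψ] at hre him
      simp only [Matrix.zero_apply]
      linarith
    exact hΨ.comp (E.injective_subtype.comp e.injective)
  · ext j k
    simp [Ψ, Matrix.star_apply]
    ring
  · have h : (e x : Matrix (Fin 2 × Fin 2) (Fin 2 × Fin 2) ℝ).trace = 0 := (e x).2
    have h' : ((e x : Matrix (Fin 2 × Fin 2) (Fin 2 × Fin 2) ℝ).trace : ℂ) = 0 := by
      rw [h, Complex.ofReal_zero]
    simp only [Matrix.trace, Matrix.diag_apply, Complex.ofReal_sum] at h'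
    simp only [Matrix.trace, Matrix.diag_apply, Ψ, LinearMap.comp_apply, LinearMap.coe_mk,
      AddHom.coe_mk, Matrix.of_apply, sub_self, Complex.ofReal_zero, zero_add,
      Complex.ofReal_add, ← Finset.sum_mul, Finset.sum_add_distrib]
    simp only [Submodule.subtype_apply, LinearEquiv.coe_coe]
    rw [h']
    simp

/-- An anti-Lipschitz parametrization of a piece of `SU(4)` of dimension at least `15`. -/
lemma TwoQubitOperator.exists_antilipschitz_chart :
    ∃ n : ℕ, 15 ≤ n ∧ ∃ φ : (Fin n → ℝ) → TwoQubitOperator, Continuous φ ∧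
      ∃ V : Set (Fin n → ℝ), IsOpen V ∧ V.Nonempty ∧
        ∃ K, AntilipschitzWith K fun x : V => (φ x : TwoQubitMatrix) := by
  obtain ⟨n, hn, Φ, hinj, hΦ⟩ := exists_injective_skewHermitian
  have hcont : Continuous Φ := Φ.continuous_of_finiteDimensional
  refine ⟨n, hn, fun x => ⟨NormedSpace.exp (Φ x), Matrix.mem_specialUnitaryGroup_iff.2 ⟨?_, ?_⟩⟩,
    ?_, ?_⟩
  · rw [Matrix.mem_unitaryGroup_iff, Matrix.star_eq_conjTranspose, ← Matrix.exp_conjTranspose,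
      ← Matrix.star_eq_conjTranspose, (hΦ x).1, Matrix.exp_neg]
    exact Matrix.mul_nonsing_inv _ ((Matrix.isUnit_iff_isUnit_det _).1 (Matrix.isUnit_exp _))
  · exact Matrix.det_exp_of_mem_skewAdjoint (hΦ x).1 (hΦ x).2
  · exact Continuous.subtype_mk (NormedSpace.exp_continuous.comp hcont) _
  -- The strict derivative of `exp` at 0 is the identity, so `exp` is anti-Lipschitz near 0, and so
  -- is its composite with the injective linear map `Φ`.
  · have hd : HasStrictFDerivAt (NormedSpace.exp : TwoQubitMatrix → TwoQubitMatrix)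
        ((ContinuousLinearEquiv.refl ℂ TwoQubitMatrix : TwoQubitMatrix ≃L[ℂ] TwoQubitMatrix) :
          TwoQubitMatrix →L[ℂ] TwoQubitMatrix) 0 := hasStrictFDerivAt_exp_zero
    obtain ⟨s, h0, hs, happ⟩ := hd.approximates_deriv_on_open_nhds
    obtain ⟨K, -, hK⟩ := Φ.exists_antilipschitzWith (LinearMap.ker_eq_bot.2 hinj)
    have hanti := happ.antilipschitz
      ((ContinuousLinearEquiv.refl ℂ TwoQubitMatrix).subsingleton_or_nnnorm_symm_pos.imp id
        fun h => NNReal.half_lt_self (inv_pos.2 h).ne')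
    obtain ⟨c, hc⟩ : ∃ c, AntilipschitzWith c
        (s.domRestrict (NormedSpace.exp : TwoQubitMatrix → TwoQubitMatrix)) := ⟨_, hanti⟩
    refine ⟨Φ ⁻¹' s, hs.preimage hcont, ⟨0, by simpa using h0⟩, K * c, fun x y => ?_⟩
    have h1 : edist x y ≤ K * edist (Φ x) (Φ y) := hK x y
    have h2 : edist (Φ x) (Φ y) ≤ c * edist (NormedSpace.exp (Φ x)) (NormedSpace.exp (Φ y)) :=
      hc ⟨Φ x, x.2⟩ ⟨Φ y, y.2⟩
    rw [ENNReal.coe_mul, mul_assoc]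
    exact h1.trans (mul_le_mul_right h2 _)

/-! ### Sets of dimension at most 14 are Haar-null -/

instance : SecondCountableTopology TwoQubitOperator :=
  haveI : SecondCountableTopology TwoQubitMatrix :=
    inferInstanceAs (SecondCountableTopology (Fin 2 × Fin 2 → Fin 2 × Fin 2 → ℂ))
  inferInstanceAs (SecondCountableTopology
    (Matrix.specialUnitaryGroup (Fin 2 × Fin 2) ℂ : Set TwoQubitMatrix))

instance : TwoQubitOperator.haar.IsMulLeftInvariant := by
  unfold TwoQubitOperator.haar; infer_instance

instance : IsFiniteMeasure TwoQubitOperator.haar := by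
  unfold TwoQubitOperator.haar; infer_instance

/-- The preimage in `SU(4)` of a set of dimension less than `15` is null for the Haar measure. -/
lemma TwoQubitOperator.haar_eq_zero_of_isClosed {m : ℕ} (hm : m ≤ 14) {S : Set TwoQubitMatrix}
    (hS : IsSmoothlyParametrized m S) {B : Set TwoQubitOperator} (hB : IsClosed B)
    (hBS : ∀ U ∈ B, (U : TwoQubitMatrix) ∈ S) : haar B = 0 := by
  obtain ⟨n, hn, φ, hφ, V, hV, hne, K, hK⟩ := exists_antilipschitz_chart
  have hmeas : MeasurableSet {q : (Fin n → ℝ) × TwoQubitOperator | φ q.1 * q.2 ∈ B} :=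
    (hB.preimage ((hφ.comp continuous_fst).mul continuous_snd)).measurableSet
  -- If `φ x * U ∈ B`, then `φ x` lies in the translate of `S` by `U⁻¹`, again of dimension at most
  -- `m`; anti-Lipschitz preimages do not raise the dimension, and `m < n`.
  have hslice (U : TwoQubitOperator) : volume.restrict V {x | φ x * U ∈ B} = 0 := by
    rw [Measure.restrict_apply' hV.measurableSet]
    obtain ⟨F, hF, hr⟩ := hS.image (f := fun A : TwoQubitMatrix => A * (U⁻¹ : TwoQubitOperator))
      (contDiff_id.mul contDiff_const)
    have hdim : dimH ({x | φ x * U ∈ B} ∩ V) ≤ (m : ENNReal) := by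
      have himage : {x | φ x * U ∈ B} ∩ V = (Subtype.val : V → _) '' {x : V | φ x * U ∈ B} := by
        ext x
        constructor
        · rintro ⟨h1, h2⟩
          exact ⟨⟨x, h2⟩, h1, rfl⟩
        · rintro ⟨y, hy, rfl⟩
          exact ⟨hy, y.2⟩
      rw [himage, isometry_subtype_coe.dimH_image]
      refine (dimH_mono ?_).trans ((hK.dimH_preimage_le (Set.range F)).trans
        (hF.dimH_range_le.trans (by simp)))
      intro x hx
      refine hr ⟨_, hBS _ hx, ?_⟩
      change ((φ x * U * U⁻¹ : TwoQubitOperator) : TwoQubitMatrix) = φ x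
      rw [mul_inv_cancel_right]
    have hlt : dimH ({x | φ x * U ∈ B} ∩ V) < ((n : NNReal) : ENNReal) := by
      refine hdim.trans_lt ?_
      have : m < n := by omega
      exact_mod_cast this
    have h := hausdorffMeasure_of_dimH_lt hlt
    have hvol : (μH[((n : NNReal) : ℝ)] : Measure (Fin n → ℝ)) = volume := by
      have := hausdorffMeasure_pi_real (ι := Fin n)
      simpa using this
    rwa [hvol] at h
  have hprod : (volume.restrict V).prod haar
      {q : (Fin n → ℝ) × TwoQubitOperator | φ q.1 * q.2 ∈ B} = 0 := by
    rw [Measure.prod_apply_symm hmeas]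
    simp only [Set.preimage_ofPred_eq, hslice, lintegral_zero]
  -- In the other order every slice is a left translate of `B`, so the product measure is `haar B`
  -- times the positive volume of `V`.
  rw [Measure.prod_apply hmeas] at hprod
  have hconst (x : Fin n → ℝ) : haar (Prod.mk x ⁻¹'
      {q : (Fin n → ℝ) × TwoQubitOperator | φ q.1 * q.2 ∈ B}) = haar B :=
    measure_preimage_mul haar (φ x) B
  simp only [hconst, lintegral_const, Measure.restrict_apply_univ, mul_eq_zero] at hprod
  exact hprod.resolve_right (hV.measure_pos volume hne).ne'

/-- Exhausting the parameter space by closed balls gives countably many compact images, to which the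
closed case applies. -/
lemma TwoQubitOperator.haar_eq_zero {m : ℕ} (hm : m ≤ 14) {S : Set TwoQubitMatrix}
    (hS : IsSmoothlyParametrized m S) :
    haar {U : TwoQubitOperator | (U : TwoQubitMatrix) ∈ S} = 0 := by
  obtain ⟨F, hF, hr⟩ := hS
  refine measure_mono_null (t := ⋃ k : ℕ, {U : TwoQubitOperator |
    (U : TwoQubitMatrix) ∈ F '' Metric.closedBall 0 k}) ?_ (measure_iUnion_null fun k => ?_)
  · intro U hU
    obtain ⟨x, hx⟩ := hr hU
    obtain ⟨k, hk⟩ := exists_nat_ge ‖x‖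
    exact Set.mem_iUnion.2 ⟨k, x, by simpa using hk, hx⟩
  · refine haar_eq_zero_of_isClosed hm (S := Set.range F) ⟨F, hF, subset_rfl⟩ ?_ ?_
    · exact (((isCompact_closedBall _ _).image hF.continuous).isClosed).preimage
        continuous_subtype_val
    · rintro U ⟨x, -, hx⟩
      exact ⟨x, hx⟩

/-! ### Conclusion -/

theorem mainTheorem7 :
    ∀ᵐ U : TwoQubitOperator ∂TwoQubitOperator.haar,
      ∀ c : BasicCircuit, BasicCircuit.Simulates c U →
        3 ≤ BasicCircuit.cnotCount c ∧ 9 ≤ BasicCircuit.gateCount c := by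
  have hfin : {z : ℂ | z ^ 8 = 1}.Countable := by
    refine (Set.Finite.subset (Polynomial.nthRoots 8 (1 : ℂ)).toFinset.finite_toSet ?_).countable
    intro z hz
    simpa [Polynomial.mem_nthRoots] using hz
  have hnull : ∀ᵐ U : TwoQubitOperator ∂TwoQubitOperator.haar, ∀ z ∈ {z : ℂ | z ^ 8 = 1},
      ∀ (p : Fin 2 → Bool) (r : List (Fin 2 × (Fin 2 → Bool))), wordDim p r ≤ 14 →
        (U : TwoQubitMatrix) ∉ (fun x => z • x) '' wordGates p r := by
    rw [ae_ball_iff hfin]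
    intro z _
    rw [ae_all_iff]
    intro p
    rw [ae_all_iff]
    intro r
    rw [ae_all_iff]
    intro h
    rw [ae_iff]
    simp only [not_not]
    exact TwoQubitOperator.haar_eq_zero h
      ((isSmoothlyParametrized_wordGates p r).image (contDiff_id.const_smul z))
  filter_upwards [hnull] with U hU c hc
  obtain ⟨y, -, hUy⟩ := hc
  obtain ⟨z, p, r, x, hx, he, hl, hw⟩ := c.exists_eval_eq_smul
  have hUz : (U : TwoQubitMatrix) = (y * z) • x := by rw [hUy, he, smul_smul]
  -- From `det U = 1` one gets `(y * z) ^ 4 * det x = 1`; squaring removes the sign of `det x`.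
  have hz : (y * z) ^ 8 = 1 := by
    have hd := (Matrix.mem_specialUnitaryGroup_iff.1 U.2).2
    rw [hUz, Matrix.det_smul, Fintype.card_prod, Fintype.card_fin] at hd
    have h2 := congrArg (· ^ 2) hd
    simp only [mul_pow, det_sq_of_mem_wordGates hx, mul_one, one_pow] at h2
    rw [mul_pow, ← h2]
    ring
  have hdim : ¬ wordDim p r ≤ 14 := fun h => hU _ hz p r h ⟨x, hx, hUz.symm⟩
  have hcount := mt (wordDim_le p r) hdim
  rw [not_or] at hcount
  omega
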